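/- Let $n$ be a positive integer, $R$ a commutative artinian ring and $\Lambda$ an artin $R$-algebra (an $R$-algebra that is finitely generated as an $R$-module). Let $\operatorname{mod}\Lambda$ be the category of finitely generated left $\Lambda$-modules, and let $\mathcal M\subseteq\operatorname{mod}\Lambda$ be an $n$-cluster tilting subcategory, that is, a functorially finite full subcategory (every $A\in\operatorname{mod}\Lambda$ has a right and a left $\mathcal M$-approximation) such that $$\mathcal M=\{X\in\operatorname{mod}\Lambda : \operatorname{Ext}^i_\Lambda(X,\mathcal M)=0\text{ for }0<i<n\}=\{X\in\operatorname{mod}\Lambda : \operatorname{Ext}^i_\Lambda(\mathcal M,X)=0\text{ for }0<i<n\};$$ one says that $(\Lambda,\mathcal M)$ is an $n$-homological pair. For an additive category $\mathcal A$, let $\operatorname{Mod}(\mathcal A)$ be the category of additive contravariant functors from $\mathcal A$ to abelian groups. Let $\operatorname{fp}(\mathcal A)$ be its full subcategory of finitely presented functors, those $F$ for which there is an exact sequence $$\operatorname{Hom}_{\mathcal A}(-,X)\xrightarrow{(-,f)}\operatorname{Hom}_{\mathcal A}(-,Y)\to F\to 0$$ with a morphism $f\colon X\to Y$ in $\mathcal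 A$, and let $\operatorname{eff}(\mathcal A)$ be its full subcategory of effaceable functors, those $F$ for which there is such a sequence with $f$ an epimorphism in $\mathcal A$. For $F\in\operatorname{Mod}(\operatorname{mod}\Lambda)$ let $F|_{\mathcal M}\in\operatorname{Mod}(\mathcal M)$ be its restriction to $\mathcal M$. Then: (1) If $F\in\operatorname{fp}(\operatorname{mod}\Lambda)$, then $F|_{\mathcal M}\in\operatorname{fp}(\mathcal M)$. (2) If $F\in\operatorname{eff}(\operatorname{mod}\Lambda)$, then $F|_{\mathcal M}\in\operatorname{eff}(\mathcal M)$. -/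

import Mathlib

open CategoryTheory

universe u v w

/-! ### Modules over an additive category -/

/-- The category `Mod(𝒜)` of `𝒜`-modules: additive contravariant functors from `𝒜` to abelian
groups, with natural transformations as morphisms. -/
abbrev CatMod (𝒜 : Type w) [Category.{v} 𝒜] [Preadditive 𝒜] :=
  𝒜ᵒᵖ ⥤+ AddCommGrpCat.{v}

/-- The sequence of functors `Hom(-, X) ⟶ Hom(-, Y) ⟶ F ⟶ 0`, whose first map is composition
with `f` and whose second map is `π`, is exact (exactness of functors is exactness at every
object). -/
def IsPresentation {𝒜 : Type w} [Category.{v} 𝒜] [Preadditive 𝒜] {X Y : 𝒜} (f : X ⟶ Y)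
    {F : CatMod 𝒜} (π : preadditiveYoneda.obj Y ⟶ F.obj) : Prop :=
  ∀ A : 𝒜ᵒᵖ, Function.Exact ((preadditiveYoneda.map f).app A) (π.app A) ∧
    Function.Surjective (π.app A)

/-- The full subcategory `fp(𝒜)` of `Mod(𝒜)`: finitely presented `𝒜`-modules, those `F` with
an exact sequence `Hom(-, X) ⟶ Hom(-, Y) ⟶ F ⟶ 0`. -/
def fp (𝒜 : Type w) [Category.{v} 𝒜] [Preadditive 𝒜] : ObjectProperty (CatMod 𝒜) :=
  fun F => ∃ (X Y : 𝒜) (f : X ⟶ Y) (π : preadditiveYoneda.obj Y ⟶ F.obj), IsPresentation f π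

/-- The full subcategory `eff(𝒜)` of `fp(𝒜)`: effaceable `𝒜`-modules, those `F` with an exact
sequence `Hom(-, X) ⟶ Hom(-, Y) ⟶ F ⟶ 0` that is induced by an epimorphism `X ⟶ Y` of `𝒜`. -/
def eff (𝒜 : Type w) [Category.{v} 𝒜] [Preadditive 𝒜] : ObjectProperty (CatMod 𝒜) :=
  fun F => ∃ (X Y : 𝒜) (f : X ⟶ Y) (π : preadditiveYoneda.obj Y ⟶ F.obj),
    Epi f ∧ IsPresentation f π

/-- The restriction of an `𝒜`-module `F` to a full subcategory of `𝒜`. -/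
def CatMod.restrict {𝒜 : Type w} [Category.{v} 𝒜] [Preadditive 𝒜] (F : CatMod 𝒜)
    (ℬ : ObjectProperty 𝒜) : CatMod ℬ.FullSubcategory :=
  haveI : F.obj.Additive := F.property
  AdditiveFunctor.of (ℬ.ι.op ⋙ F.obj)

/-! ### Cluster tilting subcategories

Full subcategories are given by the predicate that selects their objects. -/

/-- `f : M ⟶ A` is a right `ℳ`-approximation of `A`. -/
def IsRightApproximation {𝒜 : Type w} [Category.{v} 𝒜] (ℳ : ObjectProperty 𝒜) {M A : 𝒜}
    (f : M ⟶ A) : Prop :=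
  ℳ M ∧ ∀ N : 𝒜, ℳ N → ∀ g : N ⟶ A, ∃ h : N ⟶ M, h ≫ f = g

/-- `f : A ⟶ M` is a left `ℳ`-approximation of `A`. -/
def IsLeftApproximation {𝒜 : Type w} [Category.{v} 𝒜] (ℳ : ObjectProperty 𝒜) {A M : 𝒜}
    (f : A ⟶ M) : Prop :=
  ℳ M ∧ ∀ N : 𝒜, ℳ N → ∀ g : A ⟶ N, ∃ h : M ⟶ N, f ≫ h = g

/-- `ℳ` is both contravariantly finite and covariantly finite. -/
structure IsFunctoriallyFinite {𝒜 : Type w} [Category.{v} 𝒜] (ℳ : ObjectProperty 𝒜) : Prop where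
  contravariantlyFinite : ∀ A : 𝒜, ∃ (M : 𝒜) (f : M ⟶ A), IsRightApproximation ℳ f
  covariantlyFinite : ∀ A : 𝒜, ∃ (M : 𝒜) (f : A ⟶ M), IsLeftApproximation ℳ f

/-- A full subcategory `ℳ` of the category `mod Λ` of finitely generated left `Λ`-modules is
`n`-cluster tilting if it is functorially finite and
`ℳ = {X | Extⁱ(X, ℳ) = 0 for 0 < i < n} = {X | Extⁱ(ℳ, X) = 0 for 0 < i < n}`. -/
structure IsClusterTilting (n : ℕ) {Λ : Type u} [Ring Λ]
    (ℳ : ObjectProperty (FGModuleCat.{u} Λ)) : Prop where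
  functoriallyFinite : IsFunctoriallyFinite ℳ
  mem_iff_ext_left : ∀ X : FGModuleCat.{u} Λ, ℳ X ↔
    ∀ N : FGModuleCat.{u} Λ, ℳ N → ∀ i : ℕ, 0 < i → i < n →
      Subsingleton (Abelian.Ext.{u} X.obj N.obj i)
  mem_iff_ext_right : ∀ X : FGModuleCat.{u} Λ, ℳ X ↔
    ∀ N : FGModuleCat.{u} Λ, ℳ N → ∀ i : ℕ, 0 < i → i < n →
      Subsingleton (Abelian.Ext.{u} N.obj X.obj i)

/-- `(Λ, ℳ)` is an `n`-homological pair, for a positive integer `n`: `Λ` is an artin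
`R`-algebra (`R` is a commutative artinian ring and `Λ` is an `R`-algebra that is finitely
generated as an `R`-module) and `ℳ` is an `n`-cluster tilting subcategory of `mod Λ`. -/
structure IsHomologicalPair (n : ℕ) (R : Type v) [CommRing R] (Λ : Type u) [Ring Λ] [Algebra R Λ]
    (ℳ : ObjectProperty (FGModuleCat.{u} Λ)) : Prop where
  pos : 0 < n
  isArtinianRing : IsArtinianRing R
  finite : Module.Finite R Λ
  isClusterTilting : IsClusterTilting n ℳ

/-! Let `f : X ⟶ Y` present `F` and let `p : M₀ ⟶ Y` be a right `ℳ`-approximation. On `ℳ` every map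
to `Y` factors through `p`, so `Hom(-, M₀)` maps onto the restriction of `F`. Its kernel consists of
the maps that factor through the fibre product `P` of `f` and `p`; a right `ℳ`-approximation `M₁ ⟶
P` covers these, and `r : M₁ ⟶ P ⟶ M₀` presents the restriction. If `f` is epi, it is surjective,
hence so is `P ⟶ M₀`; as `Λ` lies in `ℳ`, approximations are surjective too, and so is `r`. -/

/-- A presentation of `F` by `f : X ⟶ Y` restricts to a presentation over `ℳ` by `r : M₁ ⟶ M₀`,
where `p : M₀ ⟶ Y` is a right `ℳ`-approximation and a morphism from `ℳ` to `M₀` factors through `r`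
exactly when its composite with `p` factors through `f`. -/
theorem IsPresentation.exists_restrict {𝒜 : Type w} [Category.{v} 𝒜] [Preadditive 𝒜]
    {ℳ : ObjectProperty 𝒜} {X Y : 𝒜} {f : X ⟶ Y} {F : CatMod 𝒜}
    {π : preadditiveYoneda.obj Y ⟶ F.obj} (hπ : IsPresentation f π)
    {M₀ M₁ : ℳ.FullSubcategory} {p : M₀.obj ⟶ Y} (hp : IsRightApproximation ℳ p) (r : M₁ ⟶ M₀)
    (hr : ∀ (N : 𝒜), ℳ N → ∀ g : N ⟶ M₀.obj, (∃ k : N ⟶ X, k ≫ f = g ≫ p) ↔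
      ∃ l : N ⟶ M₁.obj, l ≫ r.hom = g) :
    ∃ π' : preadditiveYoneda.obj M₀ ⟶ (F.restrict ℳ).obj, IsPresentation r π' := by
  refine ⟨preadditiveYonedaMap ℳ.ι M₀ ≫ Functor.whiskerLeft ℳ.ι.op (preadditiveYoneda.map p ≫ π),
    fun A => ⟨fun g => ?_, fun x => ?_⟩⟩
  · have key := (hπ (.op A.unop.obj)).1 (g.hom ≫ p)
    refine Iff.trans key (Iff.trans (hr _ A.unop.property g.hom) ⟨?_, ?_⟩)
    · rintro ⟨l, hl⟩
      exact ⟨ObjectProperty.homMk l, ObjectProperty.hom_ext _ hl⟩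
    · rintro ⟨l, hl⟩
      exact ⟨l.hom, congrArg InducedCategory.Hom.hom hl⟩
  · obtain ⟨y, hy⟩ := (hπ (.op A.unop.obj)).2 x
    obtain ⟨g, hg⟩ := hp.2 _ A.unop.property y
    refine ⟨ObjectProperty.homMk g, Eq.trans ?_ hy⟩
    exact congrArg (π.app (.op A.unop.obj)) hg

namespace FGModuleCat

variable {Λ : Type u} [Ring Λ]

/-- The cokernel of `f` is a quotient of `Y`, hence finitely generated, so `f` can be tested against
it. -/
theorem surjective_of_epi {X Y : FGModuleCat.{u} Λ} (f : X ⟶ Y) [Epi f] :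
    Function.Surjective f.hom.hom := by
  let q : Y ⟶ of Λ (Y ⧸ f.hom.hom.range) := ofHom f.hom.hom.range.mkQ
  have hq : f ≫ q = f ≫ 0 := by
    ext x
    exact (Submodule.Quotient.mk_eq_zero _).2 ⟨x, rfl⟩
  intro y
  have hy : q.hom.hom y = 0 := by rw [(cancel_epi f).1 hq]; rfl
  exact (Submodule.Quotient.mk_eq_zero _).1 hy

theorem epi_of_surjective {X Y : FGModuleCat.{u} Λ} (f : X ⟶ Y)
    (hf : Function.Surjective f.hom.hom) : Epi f where
  left_cancellation g h e := by
    ext y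
    obtain ⟨x, rfl⟩ := hf y
    exact congrArg (fun k : X ⟶ _ => k.hom.hom x) e

/-- The fibre product of finitely generated modules over a left noetherian ring. -/
theorem exists_fiberProduct [IsNoetherianRing Λ] {X Y Z : FGModuleCat.{u} Λ} (f : X ⟶ Y)
    (g : Z ⟶ Y) : ∃ (P : FGModuleCat.{u} Λ) (a : P ⟶ X) (b : P ⟶ Z), a ≫ f = b ≫ g ∧
      (∀ (N : FGModuleCat.{u} Λ) (k : N ⟶ X) (l : N ⟶ Z), k ≫ f = l ≫ g →
        ∃ m : N ⟶ P, m ≫ b = l) ∧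
      (Function.Surjective f.hom.hom → Function.Surjective b.hom.hom) := by
  -- `E` is a submodule of `X × Z`, finitely generated because `Λ` is noetherian.
  let E := LinearMap.eqLocus (f.hom.hom ∘ₗ LinearMap.fst Λ X Z) (g.hom.hom ∘ₗ LinearMap.snd Λ X Z)
  let a : of Λ E ⟶ X := ⟨ModuleCat.ofHom (LinearMap.fst Λ X Z ∘ₗ E.subtype)⟩
  let b : of Λ E ⟶ Z := ⟨ModuleCat.ofHom (LinearMap.snd Λ X Z ∘ₗ E.subtype)⟩
  refine ⟨of Λ E, a, b, ?_, fun N k l h => ?_, fun hf z => ?_⟩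
  · ext x
    exact x.2
  · have h' (x : N) : (k.hom.hom x, l.hom.hom x) ∈ E := congrArg (fun m : N ⟶ Y => m.hom.hom x) h
    exact ⟨⟨ModuleCat.ofHom ((k.hom.hom.prod l.hom.hom).codRestrict E h')⟩, rfl⟩
  · obtain ⟨x, hx⟩ := hf (g.hom.hom z)
    exact ⟨⟨(x, z), hx⟩, rfl⟩

/-- A right `ℳ`-approximation is surjective if `ℳ` contains the regular module. -/
theorem surjective_of_isRightApproximation {ℳ : ObjectProperty (FGModuleCat.{u} Λ)}
    (hΛ : ℳ (of Λ Λ)) {M A : FGModuleCat.{u} Λ} {f : M ⟶ A} (hf : IsRightApproximation ℳ f) :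
    Function.Surjective f.hom.hom := by
  intro x
  -- Lift the map `Λ ⟶ A` sending `1` to `x`.
  obtain ⟨h, hh⟩ := hf.2 _ hΛ ⟨ModuleCat.ofHom (LinearMap.toSpanSingleton Λ A x)⟩
  refine ⟨h.hom.hom (1 : Λ), ?_⟩
  exact (congrArg (fun k : of Λ Λ ⟶ A => k.hom.hom (1 : Λ)) hh).trans (one_smul Λ x)

end FGModuleCat

/-- `Λ` is projective, so its higher `Ext` groups vanish. -/
theorem IsClusterTilting.regular_mem {n : ℕ} {Λ : Type u} [Ring Λ]
    {ℳ : ObjectProperty (FGModuleCat.{u} Λ)} (h : IsClusterTilting n ℳ) :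
    ℳ (FGModuleCat.of Λ Λ) := by
  refine (h.mem_iff_ext_left _).2 fun N _ i hi _ => ?_
  obtain ⟨j, rfl⟩ := Nat.exists_eq_succ_of_ne_zero hi.ne'
  have : Projective (ModuleCat.of Λ Λ) :=
    (IsProjective.iff_projective (R := Λ) Λ).1 inferInstance
  exact Abelian.Ext.subsingleton_of_projective (ModuleCat.of Λ Λ) N.obj j

/-- Over a left noetherian ring, a presentation of `F` induces a presentation of the restriction of
`F` to a contravariantly finite subcategory, by a surjection if the given one is by a surjection
and the subcategory contains the regular module. -/
theorem IsPresentation.exists_isPresentation_restrict {Λ : Type u} [Ring Λ] [IsNoetherianRing Λ]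
    {ℳ : ObjectProperty (FGModuleCat.{u} Λ)}
    (hℳ : ∀ A : FGModuleCat.{u} Λ, ∃ (M : FGModuleCat.{u} Λ) (f : M ⟶ A), IsRightApproximation ℳ f)
    {X Y : FGModuleCat.{u} Λ} {f : X ⟶ Y} {F : CatMod (FGModuleCat.{u} Λ)}
    {π : preadditiveYoneda.obj Y ⟶ F.obj} (hπ : IsPresentation f π) :
    ∃ (M₁ M₀ : ℳ.FullSubcategory) (r : M₁ ⟶ M₀)
      (π' : preadditiveYoneda.obj M₀ ⟶ (F.restrict ℳ).obj), IsPresentation r π' ∧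
        (ℳ (FGModuleCat.of Λ Λ) → Function.Surjective f.hom.hom →
          Function.Surjective r.hom.hom.hom) := by
  obtain ⟨M₀, p, hp⟩ := hℳ Y
  obtain ⟨P, a, b, hab, hlift, hsurj⟩ := FGModuleCat.exists_fiberProduct f p
  obtain ⟨M₁, q, hq⟩ := hℳ P
  let r : (⟨M₁, hq.1⟩ : ℳ.FullSubcategory) ⟶ ⟨M₀, hp.1⟩ := ObjectProperty.homMk (q ≫ b)
  obtain ⟨π', hπ'⟩ := hπ.exists_restrict hp r fun N hN g => by
    constructor
    · rintro ⟨k, hk⟩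
      obtain ⟨m, rfl⟩ := hlift N k g hk
      obtain ⟨l, rfl⟩ := hq.2 N hN m
      exact ⟨l, (Category.assoc _ _ _).symm⟩
    · rintro ⟨l, rfl⟩
      exact ⟨l ≫ q ≫ a, by simp [r, hab]⟩
  exact ⟨_, _, r, π', hπ', fun hΛ hf =>
    (hsurj hf).comp (FGModuleCat.surjective_of_isRightApproximation hΛ hq)⟩

/-- Left ideals of `Λ` are `R`-submodules of a finite module over `R`, which is noetherian because
it is artinian. -/
theorem IsHomologicalPair.isNoetherianRing {n : ℕ} {R : Type v} [CommRing R] {Λ : Type u} [Ring Λ]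
    [Algebra R Λ] {ℳ : ObjectProperty (FGModuleCat.{u} Λ)} (h : IsHomologicalPair n R Λ ℳ) :
    IsNoetherianRing Λ := by
  have := h.isArtinianRing
  have := h.finite
  exact isNoetherian_of_tower R inferInstance

theorem proposition3p7 (n : ℕ) (R : Type v) [CommRing R] (Λ : Type u) [Ring Λ] [Algebra R Λ]
    (ℳ : ObjectProperty (FGModuleCat.{u} Λ)) (h : IsHomologicalPair n R Λ ℳ) :
    (∀ F : CatMod (FGModuleCat.{u} Λ),
      fp (FGModuleCat.{u} Λ) F → fp ℳ.FullSubcategory (F.restrict ℳ)) ∧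
    (∀ F : CatMod (FGModuleCat.{u} Λ),
      eff (FGModuleCat.{u} Λ) F → eff ℳ.FullSubcategory (F.restrict ℳ)) := by
  have := h.isNoetherianRing
  have hℳ := h.isClusterTilting.functoriallyFinite.contravariantlyFinite
  constructor
  · rintro F ⟨X, Y, f, π, hπ⟩
    obtain ⟨M₁, M₀, r, π', hπ', -⟩ := hπ.exists_isPresentation_restrict hℳ
    exact ⟨M₁, M₀, r, π', hπ'⟩
  · rintro F ⟨X, Y, f, π, hf, hπ⟩
    obtain ⟨M₁, M₀, r, π', hπ', hr⟩ := hπ.exists_isPresentation_restrict hℳ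
    -- `r` is epi already in `mod Λ`, and the faithful inclusion of `ℳ` reflects epimorphisms.
    have : Epi (ℳ.ι.map r) := FGModuleCat.epi_of_surjective _
      (hr h.isClusterTilting.regular_mem (FGModuleCat.surjective_of_epi f))
    exact ⟨M₁, M₀, r, π', ℳ.ι.epi_of_epi_map this, hπ'⟩
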